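/- Let $\mathbb X=\{0,1\}^*$ be the set of finite binary strings, $\Lambda$ the empty string, $|\cdot|$ the length, and $B:\mathbb X\times\mathbb X\to\mathbb X$, $B(\alpha,\gamma)=\langle\alpha,\gamma\rangle$, a fixed recursive bijection. A \emph{prefix computer} is a partial recursive function $C(p,d)$ of a program $p\in\mathbb X$ and data $d\in\mathbb X$ such that for each $d$ no program in $\{p : C(p,d)\text{ is defined}\}$ is a proper prefix of another one. Put $K_C(\alpha|d)=\min\{|p| : C(p,d)=\alpha\}$, $K_C(\alpha,\gamma|d)=K_C(\langle\alpha,\gamma\rangle|d)$ and $K_C(\alpha|\gamma,d)=K_C(\alpha|\langle\gamma,d\rangle)$. A prefix computer $U$ is \emph{universal} if for each prefix computer $C$ there is a constant $\kappa_C$ with $K_U(\alpha|d)\le K_C(\alpha|d)+\kappa_C$ for all $\alpha,d$. Fix a universal prefix computer $U$. Fix $\delta\in\mathbb N$ and a $\delta$-simple set $S\subseteq\mathbb X$, that is, a set with $|\alpha|<\delta$, $|\gamma|<\delta$ and $|\langle\alpha,\gamma\rangle|<\delta$ for all $\alpha,\gamma\in S$. For a string $s\neq\Lambda$, data $d$ and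 a constant $\kappa\in\mathbb Z$, let $\bar R^{\kappa}_s(d)$ be the list that has one entry $(r,\;|p|-K_U(s|d)+\kappa)$ for each program $p$ whose output has the form $U(p,d)=\langle r,s\rangle$. Let $R^{\kappa}_s(d)$ be the sublist of the entries with $r\in S$ if $d\in S$, and the empty list if $d\notin S$. A list of pairs $(r_k,l_k)$ satisfies the Kraft inequality if $\sum_k 2^{-l_k}\le 1$. A computer $C$ satisfies the requirements $R^\kappa_s$ if for all $d,r,l$ there are precisely as many programs $p$ of length $l$ with $C(p,d)=r$ as there are occurrences of $(r,l)$ in $R^\kappa_s(d)$. \textbf{Theorem.} \begin{enumerate} \item For all $s\ne\Lambda$ and $d$, the list $\bar R^\kappa_s(d)$ satisfies the Kraft inequality for all sufficiently large $\kappa$. For all sufficiently large $\kappa$, all the lists $R^\kappa_s(d)$ with $s\in S\setminus\{\Lambda\}$, $d\in S$ satisfy it simultaneously. \item Let $\kappa$ be any constant such that all the lists $R^\kappa_s(d)$ with $s\in S\setminus\{\Lambda\}$, $d\in S$ satisfy the Kraft inequality. Then for each $s\in S\setminus\{\Lambda\}$ there is a prefix computer $W_s$ that satisfies the requirements $R^\kappa_s$,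 and, with $W_\Lambda=U$, these can be chosen so that there is a prefix computer $W$ with $W(p,\langle s,d\rangle)=W_s(p,d)$ for all $s\in S\cup\{\Lambda\}$ and all $p,d\in\mathbb X$ (where the two sides are defined for the same arguments). \item For any constant $\kappa\in\mathbb Z$, any prefix computers $W_s$ $(s\in S\setminus\{\Lambda\})$ that satisfy the requirements $R^\kappa_s$, with $W_\Lambda=U$, and any prefix computer $W$ with $W(p,\langle s,d\rangle)=W_s(p,d)$ for all $s\in S\cup\{\Lambda\}$ and all $p,d\in\mathbb X$, and for all $\alpha,d\in S$ and $\gamma\in S\setminus\{\Lambda\}$, the three complexities below are finite and $$K_W(\alpha|\gamma,d)=K_W(\alpha,\gamma|\langle\Lambda,d\rangle)-K_W(\gamma|\langle\Lambda,d\rangle)+\kappa .$$ \end{enumerate} -/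

import Mathlib

open scoped ENNReal

noncomputable section

namespace SimpleComplexity

/-- Finite binary strings; the empty string is `[]`. -/
abbrev Str : Type := List Bool

/-- A (partial) machine: `C p d` is the output, if any, on program `p` and data `d`. -/
abbrev Machine : Type := Str → Str →. Str

/-- A prefix computer: a partial recursive function of program and data such that, for each data
string, the set of programs on which it is defined is an instantaneous code (no element is a proper
prefix of another one). -/
structure IsPrefixComputer (C : Machine) : Prop where
  partrec : Partrec₂ C
  prefix_free : ∀ d p q : Str, (C p d).Dom → (C q d).Dom → p <+: q → p = q

/-- The complexity of `a` given `d` relative to `C`: the length of a shortest program that makes `C`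
compute `a` from `d` (it is `⊤` if there is no such program). -/
def K (C : Machine) (a d : Str) : ℕ∞ :=
  ⨅ p ∈ {p : Str | a ∈ C p d}, (p.length : ℕ∞)

/-- A universal (additively optimal) prefix computer. -/
structure IsUniversal (U : Machine) : Prop where
  isPrefixComputer : IsPrefixComputer U
  optimal : ∀ C : Machine, IsPrefixComputer C → ∃ c : ℕ, ∀ a d : Str, K U a d ≤ K C a d + c

/-- A `δ`-simple set of strings, with respect to the pairing `B`. -/
def IsSimpleSet (B : Str × Str ≃ Str) (δ : ℕ) (S : Set Str) : Prop :=
  ∀ a ∈ S, ∀ c ∈ S, a.length < δ ∧ c.length < δ ∧ (B (a, c)).length < δ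

/-- A list of requirements (for one data string): the requirement with index `k` asks for a program
of length `len k` with output `result k`. Different indices may carry the same requirement. -/
structure RequirementList where
  Index : Type
  result : Index → Str
  len : Index → ℤ

/-- The Kraft inequality for a list of requirements. -/
def RequirementList.Kraft (R : RequirementList) : Prop :=
  ∑' k : R.Index, (2 : ℝ≥0∞) ^ (-R.len k) ≤ 1

/-- `C` satisfies the requirements `R d` (for all data `d`): for each output `r` and each length `l`
there are precisely as many programs of length `l` on which `C` outputs `r` from data `d` as there
are occurrences of the pair `(r, l)` in the list `R d`. -/
def Satisfies (C : Machine) (R : Str → RequirementList) : Prop :=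
  ∀ (d r : Str) (l : ℤ),
    {q : Str | (q.length : ℤ) = l ∧ r ∈ C q d}.encard =
      {k : (R d).Index | (R d).result k = r ∧ (R d).len k = l}.encard

/-- The requirements for the computer with index `s` and data `d`. There is one requirement
`(r, |p| - K_U(s|d) + κ)` for each program `p` with `U(p, d) = ⟨r, s⟩`, provided that `r` and `d`
belong to `S`. For `S = Set.univ` this is the unrestricted list. -/
def requirements (B : Str × Str ≃ Str) (U : Machine) (S : Set Str) (κ : ℤ) (s d : Str) :
    RequirementList where
  Index := {x : Str × Str // d ∈ S ∧ x.2 ∈ S ∧ B (x.2, s) ∈ U x.1 d}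
  result k := k.1.2
  len k := (k.1.1.length : ℤ) - ((K U s d).toNat : ℤ) + κ

/-- The constant `κ` is large enough: with it, all the requirement lists satisfy the Kraft
inequality. -/
def Admissible (B : Str × Str ≃ Str) (U : Machine) (S : Set Str) (κ : ℤ) : Prop :=
  ∀ s ∈ S \ {[]}, ∀ d ∈ S, (requirements B U S κ s d).Kraft

/-- The family `Ws` of computers, indexed by strings `s` in `S` and the empty string (the other
values of `Ws` are irrelevant), is a restricted class of computers over `U` with constant `κ`. -/
structure IsRestrictedClass (B : Str × Str ≃ Str) (U : Machine) (S : Set Str) (κ : ℤ)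
    (Ws : Str → Machine) : Prop where
  empty : Ws [] = U
  isPrefixComputer : ∀ s ∈ S \ {[]}, IsPrefixComputer (Ws s)
  satisfies : ∀ s ∈ S \ {[]}, Satisfies (Ws s) (requirements B U S κ s)

/-- `W` is a prefix computer that simulates all members of the class:
`W(p, ⟨s, d⟩) = W_s(p, d)`. -/
structure SimulatesClass (B : Str × Str ≃ Str) (S : Set Str) (Ws : Str → Machine)
    (W : Machine) : Prop where
  isPrefixComputer : IsPrefixComputer W
  simulates : ∀ s ∈ insert [] S, ∀ p d : Str, W p (B (s, d)) = Ws s p d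

end SimpleComplexity

end

namespace SimpleComplexity

/-! The chain rule is a shift of lengths: the programs of `Ws γ` for `α` on data `d` match the
`U`-programs for `B (α, γ)`, every length changed by the same number `-K_U(γ|d) + κ`, so the minimum
changes by that number (`chain_rule`).

For the Kraft inequality the crude choice `κ ≥ K_U(s|d)` suffices: no requirement is then shorter
than the program it comes from, and the domain of `U` on data `d` is prefix-free
(`kraft_requirements`). A simple set is finite, so one constant serves all `s` and `d` in it.

For existence, a computable enumeration of the requirements is served online by a Kraft–Chaitin
allocation (`exists_partrec_of_kraft`). The number `K_U(s|d)` is used as a fixed constant there, so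
it need not be computed: only finitely many data `B (s, d)` matter, and the resulting functions are
hard-wired into `W` by `partrec₂_override`. -/

/-! ### Allocation of a single string from free cylinders. -/

/-- The dyadic measure of the cylinder of strings extending `w`. -/
noncomputable def cylinder (w : Str) : ℝ≥0∞ := 2⁻¹ ^ w.length

/-- The siblings that are left over when the string `w` is extended by zeros to length `l`. -/
def siblings (w : Str) (l : ℕ) : List Str :=
  (List.range (l - w.length)).map fun j => w ++ List.replicate j false ++ [true]

/-- One step of the allocation fold: it uses the current string if no later one was suitable. -/
def allocStep (l : ℕ) (w : Str) (s : Option Str × List Str) : Option Str × List Str :=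
  bif s.1.isNone && decide (w.length ≤ l) then
    (some (w ++ List.replicate (l - w.length) false), siblings w l ++ s.2)
  else (s.1, w :: s.2)

/-- Allocate a string of length `l` from a list `F` of free cylinders, returning the string (if there
is room for it) and the new list of free cylinders. -/
def alloc (l : ℕ) (F : List Str) : Option Str × List Str :=
  F.foldr (allocStep l) (none, [])

/-- A list of pairwise disjoint cylinders of strictly increasing length. -/
def IsFreeList (F : List Str) : Prop :=
  F.Pairwise fun u v => u.length < v.length ∧ ¬ u <+: v

theorem alloc_cases (l : ℕ) (F : List Str) :
    (alloc l F = (none, F) ∧ ∀ u ∈ F, l < u.length) ∨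
      ∃ F₁ w F₂, F = F₁ ++ w :: F₂ ∧ w.length ≤ l ∧ (∀ u ∈ F₂, l < u.length) ∧
        alloc l F = (some (w ++ List.replicate (l - w.length) false),
          F₁ ++ (siblings w l ++ F₂)) := by
  induction F with
  | nil => left; simp [alloc]
  | cons v F ih =>
    have hv : alloc l (v :: F) = allocStep l v (alloc l F) := rfl
    rcases ih with ⟨h, hF⟩ | ⟨F₁, w, F₂, hF, hw, hl, h⟩
    · by_cases hl : v.length ≤ l
      · right
        exact ⟨[], v, F, rfl, hl, hF, by simp [hv, h, allocStep, hl]⟩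
      · left
        refine ⟨by simp [hv, h, allocStep, hl], ?_⟩
        simpa using ⟨by omega, hF⟩
    · right
      exact ⟨v :: F₁, w, F₂, by simp [hF], hw, hl, by simp [hv, h, allocStep]⟩

theorem inv_two_pow_succ_add (n : ℕ) :
    (2⁻¹ : ℝ≥0∞) ^ (n + 1) + 2⁻¹ ^ (n + 1) = 2⁻¹ ^ n := by
  rw [pow_succ, ← mul_add, ENNReal.inv_two_add_inv_two, mul_one]

theorem inv_two_pow_ne_top (n : ℕ) : (2⁻¹ : ℝ≥0∞) ^ n ≠ ⊤ := by
  simp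

theorem sum_cylinder_siblings (w : Str) {l : ℕ} (h : w.length ≤ l) :
    ((siblings w l).map cylinder).sum + 2⁻¹ ^ l = cylinder w := by
  obtain ⟨k, rfl⟩ := Nat.exists_eq_add_of_le h
  clear h
  induction k with
  | zero => simp [siblings, cylinder]
  | succ k ih =>
    rw [← ih, ← inv_two_pow_succ_add (w.length + k)]
    simp [siblings, List.range_succ, cylinder, add_assoc]

/-- The measures are finitely many distinct powers `2⁻¹ ^ m` with `m > l`, hence less than the full
geometric series. So enough total measure forces the presence of a single cylinder that is large
enough. -/
theorem sum_cylinder_lt {F : List Str} (hF : IsFreeList F) {l : ℕ} (h : ∀ u ∈ F, l < u.length) :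
    (F.map cylinder).sum < 2⁻¹ ^ l := by
  induction F generalizing l with
  | nil => simp [pos_iff_ne_zero]
  | cons v F ih =>
    rw [IsFreeList, List.pairwise_cons] at hF
    have h₁ := ih hF.2 (l := v.length) fun u hu => (hF.1 u hu).1
    obtain ⟨m, hm⟩ : ∃ m, v.length = m + 1 := ⟨v.length - 1, by have := h v (by simp); omega⟩
    calc ((v :: F).map cylinder).sum = 2⁻¹ ^ v.length + (F.map cylinder).sum := by simp [cylinder]
      _ < 2⁻¹ ^ v.length + 2⁻¹ ^ v.length := by
        exact (ENNReal.add_lt_add_iff_left (inv_two_pow_ne_top _)).2 h₁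
      _ = 2⁻¹ ^ m := by rw [hm, inv_two_pow_succ_add]
      _ ≤ 2⁻¹ ^ l := by
        have := h v (by simp)
        exact pow_le_pow_right_of_le_one' (by simp) (by omega)

theorem alloc_isSome {F : List Str} (hF : IsFreeList F) {l : ℕ}
    (h : 2⁻¹ ^ l ≤ (F.map cylinder).sum) : ∃ w, (alloc l F).1 = some w := by
  rcases alloc_cases l F with ⟨-, h'⟩ | ⟨F₁, w, F₂, -, -, -, h'⟩
  · exact absurd (sum_cylinder_lt hF h') (not_lt.2 h)
  · exact ⟨_, by rw [h']⟩

/-- Incomparability of strings in the prefix order. -/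
def Incomp (u v : Str) : Prop := ¬ u <+: v ∧ ¬ v <+: u

theorem Incomp.symm {u v : Str} (h : Incomp u v) : Incomp v u := ⟨h.2, h.1⟩

theorem Incomp.mono_right {u v w : Str} (h : Incomp u v) (hw : v <+: w) : Incomp u w := by
  refine ⟨fun hu => ?_, fun hu => h.2 (hw.trans hu)⟩
  rcases List.prefix_or_prefix_of_prefix hu hw with h' | h'
  exacts [h.1 h', h.2 h']

theorem Incomp.mono_left {u v w : Str} (h : Incomp u v) (hw : u <+: w) : Incomp w v :=
  (h.symm.mono_right hw).symm

theorem mem_siblings {w v : Str} {l : ℕ} :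
    v ∈ siblings w l ↔ ∃ j < l - w.length, v = w ++ List.replicate j false ++ [true] := by
  simp [siblings, eq_comm]

theorem incomp_zeros {w : Str} {j k : ℕ} (h : j < k) (x : Str) :
    Incomp (w ++ List.replicate k false ++ x) (w ++ List.replicate j false ++ [true]) := by
  obtain ⟨i, rfl⟩ := Nat.exists_eq_add_of_lt h
  have : w ++ List.replicate (j + i + 1) false ++ x =
      w ++ List.replicate j false ++ (false :: (List.replicate i false ++ x)) := by
    simp [List.replicate_add, List.replicate_succ', show j + i + 1 = j + (1 + i) by ring]
  -- After the common prefix `w` and `j` zeros, one string continues with a zero and the other with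
  -- a one.
  rw [this]
  constructor <;> rw [List.prefix_append_right_inj] <;> simp [List.prefix_cons_iff]

theorem isFreeList_siblings (w : Str) (l : ℕ) : IsFreeList (siblings w l) := by
  unfold IsFreeList siblings
  rw [List.pairwise_map]
  refine List.pairwise_lt_range.imp fun {a b} hab => ⟨by simpa using hab, ?_⟩
  exact (incomp_zeros hab [true]).2

theorem IsFreeList.incomp {F₁ F₂ : List Str} (h : IsFreeList (F₁ ++ F₂)) {u v : Str}
    (hu : u ∈ F₁) (hv : v ∈ F₂) : Incomp u v ∧ u.length < v.length := by
  have := (List.pairwise_append.1 h).2.2 u hu v hv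
  exact ⟨⟨this.2, fun h' => by have := h'.length_le; omega⟩, this.1⟩

/-- The fold picks the last, hence longest, cylinder `x` of length at most `l`. This keeps lengths
strictly increasing: the siblings have lengths in `(|x|, l]`, everything before `x` is shorter than
`x`, and everything after it is longer than `l`. -/
theorem alloc_spec {F : List Str} (hF : IsFreeList F) {l : ℕ} {w : Str}
    (h : (alloc l F).1 = some w) :
    w.length = l ∧ IsFreeList (alloc l F).2 ∧ (∃ u ∈ F, u <+: w) ∧
      (∀ v ∈ (alloc l F).2, (∃ u ∈ F, u <+: v) ∧ Incomp w v) ∧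
      ((alloc l F).2.map cylinder).sum + 2⁻¹ ^ l = (F.map cylinder).sum := by
  rcases alloc_cases l F with ⟨h', -⟩ | ⟨F₁, x, F₂, rfl, hx, hl, h'⟩
  · simp [h'] at h
  · obtain rfl : x ++ List.replicate (l - x.length) false = w := by simpa [h'] using h
    rw [h']
    have hx_mem : ∀ s ∈ siblings x l, x <+: s ∧ x.length < s.length ∧ s.length ≤ l := by
      intro s hs
      obtain ⟨j, hj, rfl⟩ := mem_siblings.1 hs
      simp only [List.append_assoc, List.prefix_append, List.length_append, List.length_replicate,
        List.length_singleton, true_and]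
      omega
    have hxw : x <+: x ++ List.replicate (l - x.length) false := List.prefix_append _ _
    obtain ⟨hF₁, hxF₂, hc⟩ := List.pairwise_append.1 hF
    have hF₂ := (List.pairwise_cons.1 hxF₂).2
    have h₁ : ∀ u ∈ F₁, Incomp u x ∧ u.length < x.length := fun u hu => hF.incomp hu (by simp)
    have h₂ : ∀ v ∈ F₂, Incomp x v := fun v hv =>
      (IsFreeList.incomp (F₁ := [x]) hxF₂ (by simp) hv).1
    refine ⟨by simp; omega, ?_, ⟨x, by simp, hxw⟩, ?_, ?_⟩
    · refine List.pairwise_append.2 ⟨hF₁, List.pairwise_append.2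
        ⟨isFreeList_siblings x l, hF₂, fun s hs v hv => ?_⟩, fun u hu v hv => ?_⟩
      · obtain ⟨hxs, -, hsl⟩ := hx_mem s hs
        exact ⟨hsl.trans_lt (hl v hv), ((h₂ v hv).mono_left hxs).1⟩
      · rcases List.mem_append.1 hv with hv | hv
        · obtain ⟨hxs, hsx, -⟩ := hx_mem v hv
          exact ⟨(h₁ u hu).2.trans hsx, ((h₁ u hu).1.mono_right hxs).1⟩
        · exact hc u hu v (by simp [hv])
    · intro v hv
      simp only [List.mem_append] at hv
      rcases hv with hv | hv | hv
      · exact ⟨⟨v, by simp [hv], List.prefix_rfl⟩, ((h₁ v hv).1.mono_right hxw).symm⟩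
      · refine ⟨⟨x, by simp, (hx_mem v hv).1⟩, ?_⟩
        obtain ⟨j, hj, rfl⟩ := mem_siblings.1 hv
        simpa using incomp_zeros (w := x) hj []
      · exact ⟨⟨v, by simp [hv], List.prefix_rfl⟩, (h₂ v hv).mono_left hxw⟩
    · simp only [List.map_append, List.sum_append, List.map_cons, List.sum_cons,
        ← sum_cylinder_siblings x hx]
      ring

/-! ### Online allocation for a sequence of requests. -/

/-- The list of free cylinders after the first `n` requests `e`. -/
def freeList (e : ℕ → Option ℕ) : ℕ → List Str
  | 0 => [[]]
  | n + 1 => ((e n).map fun l => (alloc l (freeList e n)).2).getD (freeList e n)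

/-- The string that is allocated to the request with index `n`. -/
def allocated (e : ℕ → Option ℕ) (n : ℕ) : Option Str :=
  (e n).bind fun l => (alloc l (freeList e n)).1

/-- The weight of an optional request for a string of given length. -/
noncomputable def weight (o : Option ℕ) : ℝ≥0∞ := o.elim 0 fun l => 2⁻¹ ^ l

variable {e : ℕ → Option ℕ}

/-- Free measure plus granted weight is always 1, so the bound on the first `n + 1` weights leaves
room for request `n`, and `alloc_isSome` turns room into success. -/
theorem freeList_spec (he : ∀ n, ∑ i ∈ Finset.range n, weight (e i) ≤ 1) (n : ℕ) :
    IsFreeList (freeList e n) ∧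
      ((freeList e n).map cylinder).sum + ∑ i ∈ Finset.range n, weight (e i) = 1 ∧
      ∀ l, e n = some l → ∃ w, (alloc l (freeList e n)).1 = some w := by
  suffices h : IsFreeList (freeList e n) ∧
      ((freeList e n).map cylinder).sum + ∑ i ∈ Finset.range n, weight (e i) = 1 by
    refine ⟨h.1, h.2, fun l hl => alloc_isSome h.1 ?_⟩
    have h₁ := he (n + 1)
    rw [Finset.sum_range_succ, ← h.2, add_comm] at h₁
    have := (ENNReal.add_le_add_iff_right ((he n).trans_lt ENNReal.one_lt_top).ne).1 h₁
    simpa [weight, hl] using this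
  induction n with
  | zero => simp [freeList, IsFreeList, cylinder]
  | succ n ih =>
    rcases hn : e n with _ | l
    · simpa [freeList, hn, Finset.sum_range_succ, weight] using ih
    · have h₁ := he (n + 1)
      rw [Finset.sum_range_succ, ← ih.2, add_comm] at h₁
      have := (ENNReal.add_le_add_iff_right ((he n).trans_lt ENNReal.one_lt_top).ne).1 h₁
      obtain ⟨w, hw⟩ := alloc_isSome ih.1 (l := l) (by simpa [weight, hn] using this)
      obtain ⟨-, h₂, -, -, h₃⟩ := alloc_spec ih.1 hw
      refine ⟨by simpa [freeList, hn] using h₂, ?_⟩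
      rw [← ih.2, ← h₃]
      simp [freeList, hn, Finset.sum_range_succ, weight]
      ring

theorem allocated_spec (he : ∀ n, ∑ i ∈ Finset.range n, weight (e i) ≤ 1) {n l : ℕ}
    (hn : e n = some l) : ∃ w, allocated e n = some w ∧ w.length = l := by
  obtain ⟨h₁, -, h₃⟩ := freeList_spec he n
  obtain ⟨w, hw⟩ := h₃ l hn
  exact ⟨w, by simp [allocated, hn, hw], (alloc_spec h₁ hw).1⟩

theorem exists_prefix_of_mem_freeList (he : ∀ n, ∑ i ∈ Finset.range n, weight (e i) ≤ 1)
    {m n : ℕ} (hmn : m ≤ n) : ∀ v ∈ freeList e n, ∃ u ∈ freeList e m, u <+: v := by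
  induction n, hmn using Nat.le_induction with
  | base => exact fun v hv => ⟨v, hv, List.prefix_rfl⟩
  | succ n _ ih =>
    intro v hv
    rcases hn : e n with _ | l
    · exact ih v (by simpa [freeList, hn] using hv)
    · obtain ⟨h₁, -, h₃⟩ := freeList_spec he n
      obtain ⟨w, hw⟩ := h₃ l hn
      obtain ⟨u, hu, huv⟩ := ((alloc_spec h₁ hw).2.2.2.1 v (by simpa [freeList, hn] using hv)).1
      obtain ⟨t, ht, htu⟩ := ih u hu
      exact ⟨t, ht, htu.trans huv⟩

/-- The later string extends a cylinder free at time `n`, which extends one free at time `m + 1`;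
the latter is incomparable with the string granted at time `m`. -/
theorem incomp_allocated (he : ∀ n, ∑ i ∈ Finset.range n, weight (e i) ≤ 1) {m n : ℕ}
    (hmn : m < n) {u v : Str} (hu : allocated e m = some u) (hv : allocated e n = some v) :
    Incomp u v := by
  obtain ⟨k, hm, hu⟩ := Option.bind_eq_some_iff.1 hu
  obtain ⟨l, -, hv⟩ := Option.bind_eq_some_iff.1 hv
  obtain ⟨x, hx, hxv⟩ := (alloc_spec (freeList_spec he n).1 hv).2.2.1
  obtain ⟨y, hy, hyx⟩ := exists_prefix_of_mem_freeList he (Nat.succ_le_of_lt hmn) x hx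
  have := ((alloc_spec (freeList_spec he m).1 hu).2.2.2.1 y (by simpa [freeList, hm] using hy)).2
  exact this.mono_right (hyx.trans hxv)

theorem eq_of_allocated_prefix (he : ∀ n, ∑ i ∈ Finset.range n, weight (e i) ≤ 1) {m n : ℕ}
    {u v : Str} (hu : allocated e m = some u) (hv : allocated e n = some v) (huv : u <+: v) :
    m = n := by
  rcases lt_trichotomy m n with h | h | h
  · exact absurd huv (incomp_allocated he h hu hv).1
  · exact h
  · exact absurd huv (incomp_allocated he h hv hu).2

/-! ### Computability of the allocation. -/

open Encodable

theorem primrec_replicate_false : Primrec fun n : ℕ => List.replicate n false := by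
  refine (Primrec.list_map Primrec.list_range
    (Primrec.const false).to₂ : Primrec fun n : ℕ => (List.range n).map fun _ => false).of_eq ?_
  intro n; simp

theorem primrec₂_siblings : Primrec₂ siblings := by
  refine Primrec.list_map (Primrec.list_range.comp (Primrec.nat_sub.comp Primrec.snd
    (Primrec.list_length.comp Primrec.fst))) ?_
  exact Primrec.list_append.comp (Primrec.list_append.comp (Primrec.fst.comp Primrec.fst)
    (primrec_replicate_false.comp Primrec.snd)) (Primrec.const [true])

theorem primrec₂_alloc : Primrec₂ alloc := by
  refine Primrec.list_foldr (α := ℕ × List Str) Primrec.snd 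
    (Primrec.const ((none, []) : Option Str × List Str))
    (h := fun a b => allocStep a.1 b.1 b.2) ?_
  have hl : Primrec fun a : (ℕ × List Str) × Str × Option Str × List Str => a.1.1 :=
    Primrec.fst.comp Primrec.fst
  have hw : Primrec fun a : (ℕ × List Str) × Str × Option Str × List Str => a.2.1 :=
    Primrec.fst.comp Primrec.snd
  have ho : Primrec fun a : (ℕ × List Str) × Str × Option Str × List Str => a.2.2.1 :=
    Primrec.fst.comp (Primrec.snd.comp Primrec.snd)
  have hF : Primrec fun a : (ℕ × List Str) × Str × Option Str × List Str => a.2.2.2 :=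
    Primrec.snd.comp (Primrec.snd.comp Primrec.snd)
  have hn : Primrec (Option.isNone : Option Str → Bool) :=
    (Primrec.not.comp Primrec.option_isSome).of_eq fun o => by cases o <;> rfl
  refine Primrec.cond (Primrec.and.comp (hn.comp ho)
    (Primrec.nat_le.comp (Primrec.list_length.comp hw) hl).decide) ?_ ?_
  · exact Primrec.pair (Primrec.option_some.comp (Primrec.list_append.comp hw
      (primrec_replicate_false.comp (Primrec.nat_sub.comp hl (Primrec.list_length.comp hw)))))
      (Primrec.list_append.comp (primrec₂_siblings.comp hw hl) hF)
  · exact Primrec.pair ho (Primrec.list_cons.comp hw hF)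

theorem computable_freeList (he : Computable e) : Computable (freeList e) := by
  have h : Computable fun n : ℕ => Nat.rec (motive := fun _ => List Str) [[]]
      (fun n F => ((e n).map fun l => (alloc l F).2).getD F) n := by
    refine Computable.nat_rec Computable.id (Computable.const ([[]] : List Str))
      (h := fun _ b => ((e b.1).map fun l => (alloc l b.2).2).getD b.2) ?_
    refine Computable.option_getD (Computable.option_map
      (he.comp (Computable.fst.comp Computable.snd)) ?_) (Computable.snd.comp Computable.snd)
    exact Computable.snd.comp (primrec₂_alloc.to_comp.comp Computable.snd
      (Computable.snd.comp (Computable.snd.comp Computable.fst)))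
  refine h.of_eq fun n => ?_
  induction n with
  | zero => rfl
  | succ n ih => simp only [freeList, ← ih]

theorem computable_allocated (he : Computable e) : Computable (allocated e) := by
  refine Computable.option_bind he ?_
  exact Computable.fst.comp (primrec₂_alloc.to_comp.comp Computable.snd
    ((computable_freeList he).comp Computable.fst))

/-! ### Enumeration without repetitions. -/

/-- Every computably enumerable single-valued relation has a computable enumeration without
repetitions. -/
theorem exists_computable_enumeration {α σ : Type*} [Primcodable α] [Primcodable σ] {g : α →. σ}
    (hg : Partrec g) : ∃ e : ℕ → Option (α × σ), Computable e ∧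
      (∀ n a r, e n = some (a, r) → r ∈ g a) ∧ (∀ a r, r ∈ g a → ∃ n, e n = some (a, r)) ∧
      ∀ m n a r r', e m = some (a, r) → e n = some (a, r') → m = n := by
  obtain ⟨c, hc⟩ := Nat.Partrec.Code.exists_code.1 hg
  have hca : ∀ a, c.eval (encode a) = (g a).map encode := fun a => by
    simp [hc, encodek]
  -- The index is a pair of stage and input code. A value is emitted only at the stage where the
  -- computation first halts, which prevents repetitions; the test on `encode a` discards
  -- non-canonical codes of the same `a`.
  let f : ℕ × ℕ → Option (α × σ) := fun n =>
    (decode (α := α) n.2).bind fun a =>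
      bif encode a == n.2 && (Nat.Partrec.Code.evaln n.1 c n.2).isNone then
        ((Nat.Partrec.Code.evaln (n.1 + 1) c n.2).bind fun x => decode (α := σ) x).map fun r =>
          (a, r)
      else none
  have hev : Primrec fun n : ℕ × ℕ => Nat.Partrec.Code.evaln n.1 c n.2 :=
    Nat.Partrec.Code.primrec_evaln.comp
      (Primrec.pair (Primrec.pair Primrec.fst (Primrec.const c)) Primrec.snd)
  have hn : Primrec (Option.isNone : Option ℕ → Bool) :=
    (Primrec.not.comp Primrec.option_isSome).of_eq fun o => by cases o <;> rfl
  have hf : Primrec f := by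
    refine Primrec.option_bind (Primrec.decode.comp Primrec.snd) ?_
    refine Primrec.cond (Primrec.and.comp (Primrec.beq.comp (Primrec.encode.comp Primrec.snd)
      (Primrec.snd.comp Primrec.fst)) (hn.comp (hev.comp Primrec.fst))) ?_ (Primrec.const none)
    refine Primrec.option_map (Primrec.option_bind (hev.comp (Primrec.pair
      (Primrec.succ.comp (Primrec.fst.comp Primrec.fst)) (Primrec.snd.comp Primrec.fst)))
      (Primrec.decode.comp Primrec.snd)) ?_
    exact Primrec.pair (Primrec.snd.comp Primrec.fst) Primrec.snd
  have hfs : ∀ t x a r, f (t, x) = some (a, r) ↔ x = encode a ∧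
      Nat.Partrec.Code.evaln t c (encode a) = none ∧
      ∃ y, Nat.Partrec.Code.evaln (t + 1) c (encode a) = some y ∧ decode y = some r := by
    intro t x a r
    simp only [f, Option.bind_eq_some_iff]
    constructor
    · rintro ⟨b, -, h⟩
      by_cases hb : (encode b == x && (Nat.Partrec.Code.evaln t c x).isNone) = true
      · rw [hb, cond_true] at h
        simp only [Bool.and_eq_true, beq_iff_eq, Option.isNone_iff_eq_none] at hb
        simp only [Option.map_eq_some_iff, Option.bind_eq_some_iff, Prod.mk.injEq] at h
        obtain ⟨r', ⟨y, hy, hr⟩, rfl, rfl⟩ := h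
        obtain ⟨rfl, hb⟩ := hb
        exact ⟨rfl, hb, y, hy, hr⟩
      · simp [Bool.eq_false_iff.2 hb] at h
    · rintro ⟨rfl, h, y, hy, hr⟩
      exact ⟨a, encodek a, by simp [h, hy, hr]⟩
  refine ⟨fun n => f n.unpair, (hf.comp Primrec.unpair).to_comp, ?_, ?_, ?_⟩
  · intro n a r h
    obtain ⟨-, -, y, hy, hr⟩ := (hfs _ _ _ _).1 h
    have := Nat.Partrec.Code.evaln_sound hy
    rw [hca, Part.mem_map_iff] at this
    obtain ⟨r', hr', rfl⟩ := this
    rw [encodek, Option.some_inj] at hr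
    exact hr ▸ hr'
  · intro a r h
    have h' : encode r ∈ c.eval (encode a) := by
      rw [hca]; exact Part.mem_map _ h
    obtain ⟨k, hk⟩ := Nat.Partrec.Code.evaln_complete.1 h'
    have hex : ∃ k, (Nat.Partrec.Code.evaln k c (encode a)) ≠ none :=
      ⟨k, by rw [Option.mem_def.1 hk]; simp⟩
    classical
    -- The first halting stage is a successor because `evaln 0` never halts.
    obtain ⟨t, ht⟩ : ∃ t, Nat.find hex = t + 1 := by
      refine Nat.exists_eq_succ_of_ne_zero fun h0 => ?_
      have := Nat.find_spec hex
      rw [h0] at this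
      simp [Nat.Partrec.Code.evaln] at this
    obtain ⟨y, hy⟩ := Option.ne_none_iff_exists'.1 (ht ▸ Nat.find_spec hex)
    have hyr : y = encode r := Part.mem_unique (Nat.Partrec.Code.evaln_sound hy) h'
    refine ⟨Nat.pair t (encode a), ?_⟩
    beta_reduce
    rw [Nat.unpair_pair, hfs]
    exact ⟨rfl, not_not.1 (Nat.find_min hex (by omega)), y, hy, by rw [hyr, encodek]⟩
  · intro m n a r r' hm hn
    obtain ⟨hm₁, hm₂, y, hm₃, -⟩ := (hfs _ _ _ _).1 hm
    obtain ⟨hn₁, hn₂, z, hn₃, -⟩ := (hfs _ _ _ _).1 hn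
    have key : ∀ {s t : ℕ} {y : ℕ}, Nat.Partrec.Code.evaln t c (encode a) = none →
        Nat.Partrec.Code.evaln (s + 1) c (encode a) = some y → t ≤ s := by
      intro s t y ht hs
      by_contra hst
      have := Nat.Partrec.Code.evaln_mono (show s + 1 ≤ t by omega) hs
      rw [ht] at this
      simp at this
    have : m.unpair = n.unpair :=
      Prod.ext (le_antisymm (key hm₂ hn₃) (key hn₂ hm₃)) (hm₁.trans hn₁.symm)
    rw [← Nat.pair_unpair m, this, Nat.pair_unpair]

/-! ### The effective Kraft inequality. -/

/-- An effective version of the Kraft inequality: a computably enumerable list of requirements that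
satisfies the Kraft inequality is met exactly by some partial recursive function with prefix-free
domain. -/
theorem exists_partrec_of_kraft {g : Str →. Str} (hg : Partrec g) {P : Str × Str → Prop}
    (hP : ∀ x, P x ↔ x.2 ∈ g x.1) (k κ : ℤ)
    (hk : ∑' x : {x : Str × Str // P x}, (2 : ℝ≥0∞) ^ (-((x.1.1.length : ℤ) - k + κ)) ≤ 1) :
    ∃ f : Str →. Str, Partrec f ∧ (∀ p q, (f p).Dom → (f q).Dom → p <+: q → p = q) ∧
      ∀ (r : Str) (l : ℤ), {q : Str | (q.length : ℤ) = l ∧ r ∈ f q}.encard =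
        {x : {x : Str × Str // P x} | x.1.2 = r ∧ (x.1.1.length : ℤ) - k + κ = l}.encard := by
  obtain ⟨e, he, he₁, he₂, he₃⟩ := exists_computable_enumeration hg
  have he₁' : ∀ {n x}, e n = some x → P x := fun {n x} h => (hP x).2 (he₁ n x.1 x.2 h)
  have he₃' : ∀ {m n x}, e m = some x → e n = some x → m = n :=
    fun {m n x} hm hn => he₃ m n x.1 x.2 x.2 hm hn
  -- A requirement of negative length would alone contribute at least 2 to the sum.
  have hpos : ∀ x, P x → 0 ≤ (x.1.length : ℤ) - k + κ := by
    intro x hx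
    by_contra! hneg
    have h₁ := (ENNReal.le_tsum (f := fun x : {x : Str × Str // P x} =>
      (2 : ℝ≥0∞) ^ (-((x.1.1.length : ℤ) - k + κ))) ⟨x, hx⟩).trans hk
    obtain ⟨m, hm⟩ : ∃ m : ℕ, -((x.1.length : ℤ) - k + κ) = ((m + 1 : ℕ) : ℤ) :=
      ⟨(-((x.1.length : ℤ) - k + κ) - 1).toNat, by omega⟩
    simp only [hm, zpow_natCast] at h₁
    exact absurd h₁ (not_le.2 (one_lt_pow₀ (by norm_num) (by simp)))
  -- Positive and negative parts of `κ` and `k` are collected so that one truncated subtraction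
  -- gives a primitive recursive length, exact whenever the integer length is nonnegative.
  let len : Str × Str → ℕ := fun x => x.1.length + κ.toNat + (-k).toNat - ((-κ).toNat + k.toNat)
  have hlen : ∀ x, P x → (len x : ℤ) = (x.1.length : ℤ) - k + κ := by
    intro x hx
    have := hpos x hx
    simp only [len]
    omega
  let E : ℕ → Option ℕ := fun n => (e n).map len
  have hlen_prim : Primrec len :=
    Primrec.nat_sub.comp (Primrec.nat_add.comp (Primrec.nat_add.comp
      (Primrec.list_length.comp Primrec.fst) (Primrec.const _)) (Primrec.const _))
      (Primrec.const _)
  have hE : Computable E := Computable.option_map he (hlen_prim.to_comp.comp Computable.snd).to₂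
  have hEs : ∀ {n x}, e n = some x → E n = some (len x) := fun h => by simp [E, h]
  have hw : ∀ n, ∑ i ∈ Finset.range n, weight (E i) ≤ 1 := by
    intro n
    refine le_trans ?_ hk
    -- Without repetitions in `e`, the steps that carry a request embed into the requirements, so
    -- the partial sums stay below the Kraft sum.
    let T : Set ℕ := {n | (e n).isSome}
    let φ : T → {x : Str × Str // P x} := fun n => ⟨(e n).get n.2, he₁' (Option.some_get n.2).symm⟩
    have hφ : Function.Injective φ := by
      intro m n hmn
      have h₁ : (e m).get m.2 = (e n).get n.2 := Subtype.ext_iff.1 hmn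
      exact Subtype.ext (he₃' (Option.some_get m.2).symm (h₁ ▸ (Option.some_get n.2).symm))
    calc ∑ i ∈ Finset.range n, weight (E i) ≤ ∑' i, weight (E i) := ENNReal.sum_le_tsum _
      _ = ∑' i : T, weight (E i) := by
        refine (tsum_subtype_eq_of_support_subset fun i hi => ?_).symm
        by_contra hT
        have : e i = none := by simpa [T] using hT
        simp [E, this, weight] at hi
      _ = ∑' i : T, (2 : ℝ≥0∞) ^ (-(((φ i).1.1.length : ℤ) - k + κ)) := by
        refine tsum_congr fun i => ?_
        rw [← hlen _ (φ i).2, hEs (Option.some_get i.2).symm, ENNReal.zpow_neg, zpow_natCast]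
        exact ENNReal.inv_pow.symm
      _ ≤ _ := ENNReal.tsum_comp_le_tsum_of_injective hφ _
  let f : Str →. Str := fun q => Nat.rfindOpt fun n =>
    bif decide (allocated E n = some q) then (e n).map Prod.snd else none
  have hf : Partrec f := by
    refine Partrec.rfindOpt ?_
    refine Computable.cond (Primrec.eq.decide.to_comp.comp ((computable_allocated hE).comp Computable.snd)
      (Computable.option_some.comp Computable.fst)) (Computable.option_map
      (he.comp Computable.snd) (Computable.snd.comp Computable.snd).to₂) (Computable.const none)
  have hmem₁ : ∀ {q r}, r ∈ f q → ∃ n x, e n = some x ∧ allocated E n = some q ∧ x.2 = r := by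
    intro q r h
    obtain ⟨n, hn⟩ := Nat.rfindOpt_spec h
    by_cases hq : allocated E n = some q
    · simp only [hq, decide_true, cond_true, Option.mem_def, Option.map_eq_some_iff] at hn
      obtain ⟨x, hx, hr⟩ := hn
      exact ⟨n, x, hx, hq, hr⟩
    · simp [hq] at hn
  have huniq : ∀ {m n p q}, allocated E m = some p → allocated E n = some q → p <+: q →
      m = n ∧ p = q := by
    intro m n p q hm hn hpq
    have hmn := eq_of_allocated_prefix hw hm hn hpq
    subst hmn
    exact ⟨rfl, Option.some_inj.1 (hm.symm.trans hn)⟩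
  have hmem₂ : ∀ {q n x}, e n = some x → allocated E n = some q → x.2 ∈ f q := by
    intro q n x hn hq
    have hd : (f q).Dom := Nat.rfindOpt_dom.2 ⟨n, x.2, by simp [hq, hn]⟩
    obtain ⟨m, y, hm, hq', hy⟩ := hmem₁ (Part.get_mem hd)
    obtain ⟨rfl, -⟩ := huniq hq hq' List.prefix_rfl
    obtain rfl : x = y := Option.some_inj.1 (hn.symm.trans hm)
    exact hy ▸ Part.get_mem hd
  refine ⟨f, hf, ?_, ?_⟩
  · intro p q hp hq hpq
    obtain ⟨m, x, -, hm, -⟩ := hmem₁ (Part.get_mem hp)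
    obtain ⟨n, y, -, hn, -⟩ := hmem₁ (Part.get_mem hq)
    exact (huniq hm hn hpq).2
  · intro r l
    -- Both sides are counted through the indices of the requests at issue: sending an index to its
    -- string and to its requirement are both injective on `N`.
    let N : Set ℕ := {n | ∃ x, e n = some x ∧ x.2 = r ∧ (x.1.length : ℤ) - k + κ = l}
    have h₁ : {q : Str | (q.length : ℤ) = l ∧ r ∈ f q} =
        (fun n => (allocated E n).getD []) '' N := by
      ext q
      constructor
      · rintro ⟨hq, hr⟩
        obtain ⟨n, x, hn, hqn, hxr⟩ := hmem₁ hr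
        refine ⟨n, ⟨x, hn, hxr, ?_⟩, by simp [hqn]⟩
        obtain ⟨w, hw₁, hw₂⟩ := allocated_spec hw (hEs hn)
        obtain rfl : q = w := Option.some_inj.1 (hqn.symm.trans hw₁)
        rw [← hlen x (he₁' hn), ← hw₂, hq]
      · rintro ⟨n, ⟨x, hn, hxr, hxl⟩, rfl⟩
        obtain ⟨w, hw₁, hw₂⟩ := allocated_spec hw (hEs hn)
        simp only [hw₁, Option.getD_some, Set.mem_ofPred_eq]
        exact ⟨by rw [hw₂, hlen x (he₁' hn), hxl], hxr ▸ hmem₂ hn hw₁⟩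
    have h₂ : Subtype.val '' {x : {x : Str × Str // P x} | x.1.2 = r ∧
        (x.1.1.length : ℤ) - k + κ = l} = (fun n => (e n).getD ([], [])) '' N := by
      ext x
      constructor
      · rintro ⟨y, hy, rfl⟩
        obtain ⟨n, hn⟩ := he₂ y.1.1 y.1.2 ((hP _).1 y.2)
        exact ⟨n, ⟨y.1, hn, hy⟩, by simp [hn]⟩
      · rintro ⟨n, ⟨y, hn, hy⟩, rfl⟩
        exact ⟨⟨y, he₁' hn⟩, hy, by simp [hn]⟩
    rw [h₁, ← Subtype.val_injective.encard_image, h₂, Set.InjOn.encard_image,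
      Set.InjOn.encard_image]
    · rintro m ⟨x, hm, -⟩ n ⟨y, hn, -⟩ hmn
      simp only [hm, hn, Option.getD_some] at hmn
      exact he₃' hm (hmn ▸ hn)
    · rintro m ⟨x, hm, -⟩ n ⟨y, hn, -⟩ hmn
      obtain ⟨v, hv, -⟩ := allocated_spec hw (hEs hm)
      obtain ⟨w, hw', -⟩ := allocated_spec hw (hEs hn)
      simp only [hv, hw', Option.getD_some] at hmn
      exact (huniq hv hw' (hmn ▸ List.prefix_rfl)).1

/-! ### Finite modifications and inverse bijections. -/

/-- A partial recursive function of two arguments may be changed at finitely many values of the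
second argument. -/
theorem partrec₂_override {α β σ : Type*} [Primcodable α] [Primcodable β] [Primcodable σ]
    [DecidableEq β] {g : α → β →. σ} (hg : Partrec₂ g) (T : Finset β) {f : β → α →. σ}
    (hf : ∀ b ∈ T, Partrec (f b)) : Partrec₂ fun a b => if b ∈ T then f b a else g a b := by
  induction T using Finset.induction_on with
  | empty => simpa using hg
  | insert c T _ ih =>
    have ih := ih fun b hb => hf b (by simp [hb])
    have hc : Computable fun x : α × β => decide (x.2 = c) :=
      (Primrec.eq.decide.to_comp.comp Computable.snd (Computable.const c)).of_eq fun _ => by congr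
    refine (Partrec.cond hc ((hf c (by simp)).comp Computable.fst) ih).of_eq ?_
    rintro ⟨a, b⟩
    by_cases h : b = c
    · simp [h]
    · simp [h]

/-- The inverse of a computable bijection is computable. -/
theorem computable_symm {α β : Type*} [Primcodable α] [Primcodable β] (e : α ≃ β)
    (he : Computable e) : Computable e.symm := by
  classical
  let f : β → ℕ → Option α := fun b n => (Encodable.decode (α := α) n).bind fun a =>
    bif decide (Encodable.encode (e a) = Encodable.encode b) then some a else none
  have hf : Computable₂ f := by
    refine Computable.option_bind (Computable.decode.comp Computable.snd) ?_
    exact Computable.cond (Primrec.eq.decide.to_comp.comp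
      (Computable.encode.comp (he.comp Computable.snd))
      (Computable.encode.comp (Computable.fst.comp Computable.fst)))
      (Computable.option_some.comp Computable.snd) (Computable.const none)
  have hfs : ∀ {b n a}, a ∈ f b n → a = e.symm b := by
    intro b n a h
    obtain ⟨x, -, hx⟩ := Option.bind_eq_some_iff.1 h
    by_cases hxb : e x = b
    · subst hxb
      simpa [eq_comm] using hx
    · simp [Encodable.encode_inj, hxb] at hx
  refine Partrec.of_eq_tot (Partrec.rfindOpt hf) fun b => ?_
  have hd : (Nat.rfindOpt (f b)).Dom := Nat.rfindOpt_dom.2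
    ⟨Encodable.encode (e.symm b), e.symm b, by simp [f, Encodable.encodek]⟩
  obtain ⟨n, hn⟩ := Nat.rfindOpt_spec (Part.get_mem hd)
  exact hfs hn ▸ Part.get_mem hd

/-! ### The Kraft inequality for prefix-free sets. -/

/-- The first codewords of two equal concatenations are prefixes of one string, hence comparable,
hence equal; they cancel. -/
theorem uniquelyDecodable_of_prefix_free {D : Set Str} (hD : ∀ p ∈ D, ∀ q ∈ D, p <+: q → p = q)
    (h₀ : [] ∉ D) : InformationTheory.UniquelyDecodable D := by
  intro L₁
  induction L₁ with
  | nil =>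
    rintro (_ | ⟨v, L₂⟩) - h₂ h
    · rfl
    · have : v = [] := by simp_all
      exact absurd (h₂ v (by simp)) (this ▸ h₀)
  | cons u L₁ ih =>
    rintro (_ | ⟨v, L₂⟩) h₁ h₂ h
    · have : u = [] := by simp_all
      exact absurd (h₁ u (by simp)) (this ▸ h₀)
    · rw [List.flatten_cons, List.flatten_cons] at h
      have hu := h₁ u (by simp)
      have hv := h₂ v (by simp)
      obtain rfl : u = v := by
        rcases List.prefix_or_prefix_of_prefix (List.prefix_append u _)
          (h ▸ List.prefix_append v _) with huv | huv
        exacts [hD u hu v hv huv, (hD v hv u hu huv).symm]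
      rw [ih L₂ (fun w hw => h₁ w (by simp [hw])) (fun w hw => h₂ w (by simp [hw]))
        (List.append_cancel_left h)]

/-- The Kraft inequality for prefix-free sets. -/
theorem tsum_inv_two_pow_length_le_one {D : Set Str}
    (hD : ∀ p ∈ D, ∀ q ∈ D, p <+: q → p = q) : ∑' p : D, (2⁻¹ : ℝ≥0∞) ^ p.1.length ≤ 1 := by
  classical
  rw [ENNReal.tsum_eq_iSup_sum]
  refine iSup_le fun T => ?_
  -- If the empty string is in `D`, it is the only element; unique decodability then fails, so this
  -- case is separate.
  by_cases h₀ : [] ∈ D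
  · have hall : ∀ p ∈ T, p = ⟨[], h₀⟩ := fun p _ =>
      Subtype.ext (hD [] h₀ p p.2 List.nil_prefix).symm
    calc ∑ p ∈ T, (2⁻¹ : ℝ≥0∞) ^ p.1.length ≤ ∑ p ∈ {(⟨[], h₀⟩ : D)}, 2⁻¹ ^ p.1.length :=
          Finset.sum_le_sum_of_subset fun p hp => by simp [hall p hp]
      _ = 1 := by simp
  · have hud : InformationTheory.UniquelyDecodable
        ((T.map (Function.Embedding.subtype _) : Finset Str) : Set Str) := by
      refine uniquelyDecodable_of_prefix_free (fun p hp q hq => ?_) ?_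
      · simp only [Finset.coe_map, Set.mem_image] at hp hq
        obtain ⟨p, -, rfl⟩ := hp
        obtain ⟨q, -, rfl⟩ := hq
        exact hD p p.2 q q.2
      · simp [h₀]
    have h := InformationTheory.kraft_mcmillan_inequality hud
    rw [Finset.sum_map] at h
    have h' := ENNReal.ofReal_le_ofReal h
    rw [ENNReal.ofReal_sum_of_nonneg (fun _ _ => by positivity), ENNReal.ofReal_one] at h'
    refine le_trans (le_of_eq (Finset.sum_congr rfl fun p _ => ?_)) h'
    rw [ENNReal.ofReal_pow (by positivity)]
    simp [ENNReal.ofReal_inv_of_pos]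

/-! ### Complexities, the restricted class and the chain rule. -/

variable {C : Machine} {a d : Str}

theorem K_le_length {p : Str} (h : a ∈ C p d) : K C a d ≤ p.length :=
  iInf₂_le p h

theorem exists_length_eq_K (h : K C a d ≠ ⊤) : ∃ p, a ∈ C p d ∧ K C a d = p.length := by
  have hne : ((fun p : Str => (p.length : ℕ∞)) '' {p | a ∈ C p d}).Nonempty := by
    by_contra hne
    rw [Set.not_nonempty_iff_eq_empty, Set.image_eq_empty] at hne
    simp [K, hne] at h
  obtain ⟨p, hp, hpK⟩ := csInf_mem hne
  exact ⟨p, hp, by rw [K, ← sInf_image]; exact hpK.symm⟩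

theorem IsUniversal.K_ne_top {U : Machine} (hU : IsUniversal U) (a d : Str) : K U a d ≠ ⊤ := by
  -- This computer outputs `a` on the empty program only; comparing `U` with it bounds `K U a d`.
  let C : Machine := fun p _ => (if p = [] then some a else none : Option Str)
  have hC : IsPrefixComputer C := by
    refine ⟨?_, ?_⟩
    · have : Computable fun x : Str × Str => if x.1 = [] then some a else none :=
        (Primrec.ite (Primrec.eq.comp Primrec.fst (Primrec.const [])) (Primrec.const (some a))
          (Primrec.const none)).to_comp
      exact this.ofOption
    · intro d p q hp hq _
      by_cases h₁ : p = [] <;> by_cases h₂ : q = [] <;> simp_all [C]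
  obtain ⟨c, hc⟩ := hU.optimal C hC
  have h₀ : K C a d ≤ 0 := K_le_length (p := []) (by simp [C])
  exact ne_top_of_le_ne_top (by simp) ((hc a d).trans (add_le_add_left h₀ _))

variable {B : Str × Str ≃ Str} {U : Machine} {S : Set Str} {κ : ℤ}

theorem kraft_requirements (hU : IsUniversal U) {s d : Str} (h : ((K U s d).toNat : ℤ) ≤ κ) :
    (requirements B U S κ s d).Kraft := by
  have hpf : ∀ p ∈ {p | (U p d).Dom}, ∀ q ∈ {p | (U p d).Dom}, p <+: q → p = q :=
    fun p hp q hq => hU.isPrefixComputer.prefix_free d p q hp hq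
  let φ : (requirements B U S κ s d).Index → {p | (U p d).Dom} :=
    fun k => ⟨k.1.1, Part.dom_iff_mem.2 ⟨_, k.2.2.2⟩⟩
  -- Each program yields at most one requirement, since `U` is single-valued and `B` injective.
  have hφ : Function.Injective φ := by
    rintro ⟨⟨p, r⟩, _, _, h₁⟩ ⟨⟨q, r'⟩, _, _, h₂⟩ hpq
    obtain rfl : p = q := Subtype.ext_iff.1 hpq
    exact Subtype.ext (Prod.ext rfl (Prod.mk.inj (B.injective (Part.mem_unique h₁ h₂))).1)
  refine le_trans (ENNReal.tsum_le_tsum fun k => ?_)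
    ((ENNReal.tsum_comp_le_tsum_of_injective hφ _).trans (tsum_inv_two_pow_length_le_one hpf))
  calc (2 : ℝ≥0∞) ^ (-(requirements B U S κ s d).len k)
      ≤ 2 ^ (-((φ k).1.length : ℤ)) := by
        refine ENNReal.zpow_le_of_le (by norm_num) ?_
        simp only [requirements, φ]
        omega
    _ = 2⁻¹ ^ (φ k).1.length := by rw [ENNReal.zpow_neg, zpow_natCast, ENNReal.inv_pow]

theorem IsSimpleSet.finite {δ : ℕ} (hS : IsSimpleSet B δ S) : S.Finite :=
  (List.finite_length_lt Bool δ).subset fun a ha => (hS a ha a ha).1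

theorem exists_isRestrictedClass (hB : Computable B) (hU : IsPrefixComputer U) (hS : S.Finite)
    (hκ : Admissible B U S κ) : ∃ (Ws : Str → Machine) (W : Machine),
      IsRestrictedClass B U S κ Ws ∧ SimulatesClass B S Ws W := by
  classical
  have hB' : Computable B.symm := computable_symm B hB
  -- With `s` and `d` fixed, the filter on the outputs of `U` is a finite table, so no uniformity in
  -- `s` and `d` is needed.
  have hg : ∀ s d, Partrec fun p => (U p d).bind fun o =>
      (if o ∈ hS.toFinset.image (fun r => B (r, s)) then Part.some (B.symm o).1 else Part.none :
        Part Str) := by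
    intro s d
    refine Partrec.bind (hU.partrec.comp Computable.id (Computable.const d)) ?_
    exact partrec₂_override (f := fun o (_ : Str) => Part.some (B.symm o).1)
      Partrec.none.to₂ _ fun _ _ => (Computable.const _).partrec
  have hf : ∀ e : Str, ∃ f : Str →. Str, Partrec f ∧
      (∀ p q, (f p).Dom → (f q).Dom → p <+: q → p = q) ∧ ∀ s ∈ S \ {[]}, ∀ d ∈ S, e = B (s, d) →
        ∀ (r : Str) (l : ℤ), {q : Str | (q.length : ℤ) = l ∧ r ∈ f q}.encard =
          {k : (requirements B U S κ s d).Index | (requirements B U S κ s d).result k = r ∧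
            (requirements B U S κ s d).len k = l}.encard := by
    intro e
    by_cases he : ∃ s ∈ S \ {[]}, ∃ d ∈ S, e = B (s, d)
    · obtain ⟨s, hs, d, hd, rfl⟩ := he
      obtain ⟨f, hf₁, hf₂, hf₃⟩ := exists_partrec_of_kraft (hg s d)
        (P := fun x => d ∈ S ∧ x.2 ∈ S ∧ B (x.2, s) ∈ U x.1 d) (fun x => by
          simp only [Part.mem_bind_iff]
          constructor
          · rintro ⟨-, h₁, h₂⟩
            refine ⟨_, h₂, ?_⟩
            rw [if_pos (Finset.mem_image.2 ⟨x.2, by simpa using h₁, rfl⟩)]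
            simp
          · rintro ⟨o, ho, hx⟩
            split_ifs at hx with h
            · obtain ⟨r, hr, rfl⟩ := Finset.mem_image.1 h
              obtain rfl : x.2 = r := by simpa using hx
              exact ⟨hd, by simpa using hr, ho⟩
            · exact absurd hx (Part.notMem_none _)) ((K U s d).toNat : ℤ) κ (hκ s hs d hd)
      refine ⟨f, hf₁, hf₂, fun s' _ d' _ h => ?_⟩
      obtain ⟨rfl, rfl⟩ : s = s' ∧ d = d' := by simpa using h
      exact hf₃
    · refine ⟨fun _ => Part.none, Partrec.none, fun p q hp => absurd hp (by simp), ?_⟩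
      intro s hs d hd h
      exact absurd ⟨s, hs, d, hd, h⟩ he
  choose f hf₁ hf₂ hf₃ using hf
  let T : Finset Str := ((hS.toFinset.filter (· ≠ [])) ×ˢ hS.toFinset).image B
  have hT : ∀ s d, B (s, d) ∈ T ↔ s ∈ S \ {[]} ∧ d ∈ S := by
    intro s d
    simp [T]
  -- Off the finite table `T`, data of the form `B ([], d)` are passed to `U`, and all other data
  -- give no output.
  let W₀ : Machine := fun p e =>
    bif decide ((B.symm e).1 = []) then U p (B.symm e).2 else Part.none
  have hW₀ : Partrec₂ W₀ := by
    have h : Computable fun x : Str × Str => B.symm x.2 := hB'.comp Computable.snd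
    exact Partrec.cond (Primrec.eq.decide.to_comp.comp (Computable.fst.comp h)
      (Computable.const [])) (hU.partrec.comp Computable.fst (Computable.snd.comp h)) Partrec.none
  let W : Machine := fun p e => if e ∈ T then f e p else W₀ p e
  have hW : IsPrefixComputer W := by
    refine ⟨partrec₂_override hW₀ T fun e _ => hf₁ e, fun e p q hp hq hpq => ?_⟩
    by_cases he : e ∈ T
    · simp only [W, if_pos he] at hp hq
      exact hf₂ e p q hp hq hpq
    · simp only [W, if_neg he, W₀] at hp hq
      by_cases h : (B.symm e).1 = []
      · simp only [h, decide_true, cond_true] at hp hq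
        exact hU.prefix_free _ p q hp hq hpq
      · simp [h] at hp
  refine ⟨fun s p d => W p (B (s, d)), W, ⟨?_, fun s _ => ⟨?_, ?_⟩, fun s hs d r l => ?_⟩, hW,
    fun _ _ _ _ => rfl⟩
  · funext p d
    have : B ([], d) ∉ T := by simp [hT]
    simp [W, W₀, this]
  · exact hW.partrec.comp Computable.fst (hB.comp (Computable.pair (Computable.const s)
      Computable.snd))
  · exact fun d => hW.prefix_free (B (s, d))
  · by_cases hd : d ∈ S
    · simp only [W, if_pos ((hT s d).2 ⟨hs, hd⟩)]
      exact hf₃ _ s hs d hd rfl r l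
    · have h₁ : B (s, d) ∉ T := fun h => hd ((hT s d).1 h).2
      have h₂ : s ≠ [] := by simpa using hs.2
      have : IsEmpty (requirements B U S κ s d).Index := ⟨fun k => hd k.2.1⟩
      simp [W, h₁, W₀, h₂, Set.eq_empty_of_isEmpty]

/-- Equal multiplicities are used only through nonemptiness: a shortest `U`-program for the pair
gives a `Ws γ`-program of the shifted length, and a shortest `Ws γ`-program comes from some
`U`-program for the pair. The Kraft inequality plays no role. -/
theorem chain_rule (hU : IsUniversal U) {Ws : Str → Machine} {W : Machine}
    (hWs : IsRestrictedClass B U S κ Ws) (hW : SimulatesClass B S Ws W) {α d γ : Str}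
    (hα : α ∈ S) (hd : d ∈ S) (hγ : γ ∈ S \ {[]}) :
    K W α (B (γ, d)) ≠ ⊤ ∧ K W (B (α, γ)) (B ([], d)) ≠ ⊤ ∧ K W γ (B ([], d)) ≠ ⊤ ∧
      ((K W α (B (γ, d))).toNat : ℤ) = ((K W (B (α, γ)) (B ([], d))).toNat : ℤ) -
        ((K W γ (B ([], d))).toNat : ℤ) + κ := by
  have h₀ : ∀ a, K W a (B ([], d)) = K U a d := fun a => by
    simp only [K, hW.simulates [] (by simp), hWs.empty]
  have hγ' : K W α (B (γ, d)) = K (Ws γ) α d := by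
    simp only [K, hW.simulates γ (Or.inr hγ.1)]
  rw [h₀, h₀, hγ']
  have hsat := hWs.satisfies γ hγ d α
  obtain ⟨p, hp, hpK⟩ := exists_length_eq_K (hU.K_ne_top (B (α, γ)) d)
  obtain ⟨q, hql, hq⟩ : {q : Str | (q.length : ℤ) = (p.length : ℤ) - ((K U γ d).toNat : ℤ) + κ ∧
      α ∈ Ws γ q d}.Nonempty := by
    rw [← Set.encard_pos, hsat, Set.encard_pos]
    exact ⟨⟨(p, α), hd, hα, hp⟩, rfl, rfl⟩
  have hfin : K (Ws γ) α d ≠ ⊤ := ne_top_of_le_ne_top (by simp) (K_le_length hq)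
  obtain ⟨q', hq', hqK⟩ := exists_length_eq_K hfin
  obtain ⟨⟨⟨p', r⟩, h₁, h₂, h₃⟩, h₄, h₅⟩ : {k : (requirements B U S κ γ d).Index |
      (requirements B U S κ γ d).result k = α ∧
        (requirements B U S κ γ d).len k = q'.length}.Nonempty := by
    rw [← Set.encard_pos, ← hsat, Set.encard_pos]
    exact ⟨q', rfl, hq'⟩
  obtain rfl : r = α := h₄
  have h₅' : (p'.length : ℤ) - ((K U γ d).toNat : ℤ) + κ = q'.length := h₅
  have hq'q : q'.length ≤ q.length := by
    have := K_le_length hq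
    rw [hqK] at this
    exact_mod_cast this
  have hpp' : p.length ≤ p'.length := by
    have := K_le_length h₃
    rw [hpK] at this
    exact_mod_cast this
  refine ⟨hfin, hU.K_ne_top _ _, hU.K_ne_top _ _, ?_⟩
  rw [hqK, hpK, ENat.toNat_natCast, ENat.toNat_natCast]
  omega

end SimpleComplexity

theorem mainTheorem1
    (B : SimpleComplexity.Str × SimpleComplexity.Str ≃ SimpleComplexity.Str)
    (hB : Computable (fun x : SimpleComplexity.Str × SimpleComplexity.Str => B x))
    (U : SimpleComplexity.Machine) (hU : SimpleComplexity.IsUniversal U)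
    (δ : ℕ) (S : Set SimpleComplexity.Str) (hS : SimpleComplexity.IsSimpleSet B δ S) :
    -- the Kraft inequality holds for the unrestricted lists if the constant is large enough
    (∀ s d : SimpleComplexity.Str, s ≠ [] → ∃ κ₀ : ℤ, ∀ κ : ℤ, κ₀ ≤ κ →
      (SimpleComplexity.requirements B U Set.univ κ s d).Kraft) ∧
    -- one constant can be used for the whole set `S`
    (∃ κ₀ : ℤ, ∀ κ : ℤ, κ₀ ≤ κ → SimpleComplexity.Admissible B U S κ) ∧
    -- for each such constant the class of computers and the computer `W` exist
    (∀ κ : ℤ, SimpleComplexity.Admissible B U S κ →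
      ∃ (Ws : SimpleComplexity.Str → SimpleComplexity.Machine) (W : SimpleComplexity.Machine),
        SimpleComplexity.IsRestrictedClass B U S κ Ws ∧
        SimpleComplexity.SimulatesClass B S Ws W) ∧
    -- the chain rule, with finite complexities, for all such classes and computers
    (∀ (κ : ℤ) (Ws : SimpleComplexity.Str → SimpleComplexity.Machine)
      (W : SimpleComplexity.Machine),
      SimpleComplexity.IsRestrictedClass B U S κ Ws →
      SimpleComplexity.SimulatesClass B S Ws W →
      ∀ α ∈ S, ∀ d ∈ S, ∀ γ ∈ S \ {[]},
        SimpleComplexity.K W α (B (γ, d)) ≠ ⊤ ∧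
        SimpleComplexity.K W (B (α, γ)) (B ([], d)) ≠ ⊤ ∧
        SimpleComplexity.K W γ (B ([], d)) ≠ ⊤ ∧
        ((SimpleComplexity.K W α (B (γ, d))).toNat : ℤ) =
          ((SimpleComplexity.K W (B (α, γ)) (B ([], d))).toNat : ℤ) -
            ((SimpleComplexity.K W γ (B ([], d))).toNat : ℤ) + κ) := by
  refine ⟨fun s d _ => ⟨((SimpleComplexity.K U s d).toNat : ℤ), fun κ h =>
    SimpleComplexity.kraft_requirements hU h⟩, ?_,
    fun κ h => SimpleComplexity.exists_isRestrictedClass hB hU.isPrefixComputer hS.finite h,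
    fun κ Ws W hWs hW α hα d hd γ hγ => SimpleComplexity.chain_rule hU hWs hW hα hd hγ⟩
  obtain ⟨b, hb⟩ := ((hS.finite.prod hS.finite).image fun x : SimpleComplexity.Str ×
    SimpleComplexity.Str => ((SimpleComplexity.K U x.1 x.2).toNat : ℤ)).bddAbove
  exact ⟨b, fun κ h s hs d hd => SimpleComplexity.kraft_requirements hU
    ((hb ⟨(s, d), ⟨hs.1, hd⟩, rfl⟩).trans h)⟩
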